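/- Let $G$ be a torsion-free abelian group of finite rank $d\ge 1$ and let $\varphi,\psi$ be endomorphisms of $G$. For $n\ge 1$ let $R(\varphi^n,\psi^n)$ be the number of classes of the equivalence relation on $G$ given by $x\sim y$ if and only if $x=-\varphi^n(g)+y+\psi^n(g)$ for some $g\in G$, and suppose that the pair $(\varphi,\psi)$ is tame, i.e. $R(\varphi^n,\psi^n)<\infty$ for all $n\ge 1$. Let $\varphi_{\mathbb Q},\psi_{\mathbb Q}$ be the extensions of $\varphi,\psi$ to $G_{\mathbb Q}=\mathbb Q\otimes_{\mathbb Z}G\cong\mathbb Q^d$, and suppose that they are simultaneously triangularisable, i.e. that over some finite extension $F$ of $\mathbb Q$ the induced endomorphisms of $F\otimes_{\mathbb Q}G_{\mathbb Q}$ preserve a common complete flag of subspaces. Let $\xi_1,\dots,\xi_d$ and $\eta_1,\dots,\eta_d$ be the eigenvalues, with multiplicities, of $\varphi_{\mathbb Q}$ and $\psi_{\mathbb Q}$ in an algebraic closure $K$ of $\mathbb Q$, numbered consistently with a simultaneous triangularisation: there is a complete flag of $K\otimes_{\mathbb Q}G_{\mathbb Q}$ preserved by both endomorphisms such that on its $d$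 one-dimensional successive quotients they act as the scalars $\xi_i$ and $\eta_i$ respectively, each index $i\in\{1,\dots,d\}$ occurring for exactly one quotient. (In particular the eigenvalues of $\varphi_{\mathbb Q}^n-\psi_{\mathbb Q}^n$ are $\xi_1^n-\eta_1^n,\dots,\xi_d^n-\eta_d^n$ for all $n\ge1$.) Let $L=\mathbb Q(\xi_1,\dots,\xi_d,\eta_1,\dots,\eta_d)$. For each prime $p$ fix an embedding $L\hookrightarrow\overline{\mathbb Q}_p$ and let $|\cdot|_p$ be the unique extension of the $p$-adic absolute value to $\overline{\mathbb Q}_p$; fix also an embedding $L\hookrightarrow\mathbb C$ and let $|\cdot|_\infty$ be the usual absolute value on $\mathbb C$. Then there are subsets $I(p)\subseteq\{1,\dots,d\}$, one for each prime $p$, such that the following hold. (1) For each prime $p$, the polynomials $\prod_{i\in I(p)}(X-\xi_i)$ and $\prod_{i\in I(p)}(X-\eta_i)$ have coefficients in $\mathbb Z_p$; in particular $|\xi_i|_p\le1$ and $|\eta_i|_p\le 1$ for all $i\in I(p)$. (2) For each $n\ge1$, one has $|\xi_i^n-\eta_i^n|_p=1$ for all $1\le i\le d$ and all but finitely many primes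 $p$, and $R(\varphi^n,\psi^n)$ is a positive integer with $$R(\varphi^n,\psi^n)=\prod_p\prod_{i\in I(p)}|\xi_i^n-\eta_i^n|_p^{-1}=\prod_{i=1}^d|\xi_i^n-\eta_i^n|_\infty\cdot\prod_p\prod_{i\notin I(p)}|\xi_i^n-\eta_i^n|_p,$$ where $p$ runs over all primes. -/

import Mathlib

open scoped TensorProduct Polynomial

/-! ### Twisted conjugacy and Reidemeister numbers (groups are written additively) -/

/-- `x` and `y` are `(φ, ψ)`-twisted conjugate if `x = (g φ)⁻¹ y (g ψ)` for some `g`. -/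
def TwistedConj {G : Type*} [AddGroup G] (φ ψ : AddMonoid.End G) (x y : G) : Prop :=
  ∃ g : G, x = -(φ g) + y + ψ g

/-- The equivalence relation of `(φ, ψ)`-twisted conjugacy. -/
def twistedConjSetoid {G : Type*} [AddGroup G] (φ ψ : AddMonoid.End G) : Setoid G where
  r := TwistedConj φ ψ
  iseqv :=
    { refl := fun x => ⟨0, by simp⟩
      symm := by
        rintro x y ⟨g, rfl⟩
        exact ⟨-g, by simp [add_assoc]⟩
      trans := by
        rintro x y z ⟨g, rfl⟩ ⟨h, rfl⟩
        exact ⟨h + g, by simp [add_assoc]⟩ }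

/-- The set of `(φ, ψ)`-coincidence Reidemeister classes. -/
def ReidemeisterClasses {G : Type*} [AddGroup G] (φ ψ : AddMonoid.End G) : Type _ :=
  Quotient (twistedConjSetoid φ ψ)

/-- The `(φ, ψ)`-coincidence Reidemeister number, an element of `{0, 1, 2, …, ∞}`. -/
noncomputable def reidemeisterNumber {G : Type*} [AddGroup G] (φ ψ : AddMonoid.End G) : ℕ∞ :=
  ENat.card (ReidemeisterClasses φ ψ)

/-- The pair `(φ, ψ)` is tame if all `R(φⁿ, ψⁿ)`, `n ≥ 1`, are finite. -/
def IsTamePair {G : Type*} [AddGroup G] (φ ψ : AddMonoid.End G) : Prop :=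
  ∀ n : ℕ, 1 ≤ n → reidemeisterNumber (φ ^ n) (ψ ^ n) ≠ ⊤

/-! ### Divisible hull and simultaneous triangularisation -/

/-- The extension of an endomorphism of an abelian group `G` to `ℚ ⊗ G`. -/
noncomputable def rationalExtension {G : Type*} [AddCommGroup G] (φ : AddMonoid.End G) :
    (ℚ ⊗[ℤ] G) →ₗ[ℚ] (ℚ ⊗[ℤ] G) :=
  (AddMonoidHom.toIntLinearMap φ).baseChange ℚ

/-- A complete flag `0 = W 0 ⊂ W 1 ⊂ … ⊂ W d = V` with `dim (W i) = i`. -/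
structure IsCompleteFlag {F V : Type*} [Field F] [AddCommGroup V] [Module F V] {d : ℕ}
    (W : Fin (d + 1) → Submodule F V) : Prop where
  bot : W 0 = ⊥
  top : W (Fin.last d) = ⊤
  mono : Monotone W
  finrank_eq : ∀ i, Module.finrank F (W i) = (i : ℕ)

/-- Two endomorphisms of a finite-dimensional `ℚ`-vector space `V` are (absolutely) simultaneously
triangularisable if they preserve a common complete flag of `L ⊗ V` for some finite extension
`L` of `ℚ`. -/
def SimultaneouslyTriangularisable {V : Type*} [AddCommGroup V] [Module ℚ V]
    (α β : V →ₗ[ℚ] V) : Prop :=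
  ∃ (L : Type) (_ : Field L) (_ : Algebra ℚ L), FiniteDimensional ℚ L ∧
    ∃ W : Fin (Module.finrank ℚ V + 1) → Submodule L (L ⊗[ℚ] V), IsCompleteFlag W ∧
      ∀ i, ∀ v ∈ W i, α.baseChange L v ∈ W i ∧ β.baseChange L v ∈ W i

/-- `ξ` and `η` list the eigenvalues of `α` and `β` in `K`, with multiplicities, and are numbered
consistently with a simultaneous triangularisation: there is a complete flag of `K ⊗ V` such that
`α` and `β` act on its successive one-dimensional quotients as the scalars `ξ j` and `η j`, each
index `j` occurring exactly once. -/
def IsJointEigenvalueNumbering {V : Type*} [AddCommGroup V] [Module ℚ V] (α β : V →ₗ[ℚ] V)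
    {K : Type*} [Field K] [Algebra ℚ K] {d : ℕ} (ξ η : Fin d → K) : Prop :=
  ∃ (W : Fin (d + 1) → Submodule K (K ⊗[ℚ] V)) (π : Equiv.Perm (Fin d)), IsCompleteFlag W ∧
    ∀ i : Fin d, ∀ v ∈ W i.succ,
      α.baseChange K v - ξ (π i) • v ∈ W i.castSucc ∧
      β.baseChange K v - η (π i) • v ∈ W i.castSucc

/-! ### The field generated by the eigenvalues, and `p`-adic notions -/

/-- The field `L = ℚ(ξ₁, …, ξ_d, η₁, …, η_d)`. -/
def eigenvalueField {K : Type*} [Field K] [Algebra ℚ K] {d : ℕ} (ξ η : Fin d → K) :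
    IntermediateField ℚ K :=
  IntermediateField.adjoin ℚ (Set.range ξ ∪ Set.range η)

/-- `ξ i` as an element of `L`. -/
def eigenvalueFst {K : Type*} [Field K] [Algebra ℚ K] {d : ℕ} (ξ η : Fin d → K) (i : Fin d) :
    eigenvalueField ξ η :=
  ⟨ξ i, IntermediateField.subset_adjoin ℚ _ (Or.inl ⟨i, rfl⟩)⟩

/-- `η i` as an element of `L`. -/
def eigenvalueSnd {K : Type*} [Field K] [Algebra ℚ K] {d : ℕ} (ξ η : Fin d → K) (i : Fin d) :
    eigenvalueField ξ η :=
  ⟨η i, IntermediateField.subset_adjoin ℚ _ (Or.inr ⟨i, rfl⟩)⟩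

instance factPrimeOfPrimes (p : Nat.Primes) : Fact (p : ℕ).Prime := ⟨p.2⟩

/-- A polynomial over `ℚ̄_p` has all its coefficients in `ℤ_p`. -/
def HasPadicIntCoeffs (p : ℕ) [Fact p.Prime] (f : (PadicAlgCl p)[X]) : Prop :=
  ∀ k : ℕ, ∃ c : ℤ_[p], f.coeff k = algebraMap ℚ_[p] (PadicAlgCl p) (c : ℚ_[p])

/-! The classes are the cosets of the image of A = φⁿ - ψⁿ, so R = |G/AG|, and it suffices to find
its p-part for every p. Let H be ℤ_p ⊗ G modulo its infinitely p-divisible elements (`padicHull`).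
It is free of finite rank. The discarded elements die in the finite group ℤ_p ⊗ G/AG, so A has the
same cokernel on H (`padicHull.card_quotient_range`), and Smith normal form gives its order as
|det(A on H)|_p⁻¹ (`card_quotient_range_eq_norm_det`).

The space ℚ̄_p ⊗ H is spanned by an equivariant image of G. A basis adapted to the given flag
therefore maps to a spanning, possibly dependent, family on which φ and ψ are still triangular. The
indices whose vector is not in the span of its predecessors (`jumps`) yield a basis; up to
renumbering they form I(p), which does not depend on n, and det(A on H) = ∏_{i ∈ I(p)} (ξᵢⁿ - ηᵢⁿ)
(`IsJointEigenvalueNumbering.exists_indices`). Integrality of the two polynomials holds because they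
are characteristic polynomials on H.

Multiplying the p-parts gives the first formula. The second follows from the product formula for the
rational number det(A on ℚ ⊗ G) = ∏ᵢ (ξᵢⁿ - ηᵢⁿ), nonzero because G/AG is finite. -/

/-! ### Triangular endomorphisms on a spanning, possibly dependent, family -/

section Triangular

variable {E S : Type*} [Field E] [AddCommGroup S] [Module E S] {d : ℕ}

/-- The span of the vectors of index less than `i`. -/
def spanBefore (E : Type*) {S : Type*} [Field E] [AddCommGroup S] [Module E S] {d : ℕ}
    (w : Fin d → S) (i : Fin d) : Submodule E S :=
  Submodule.span E (w '' Set.Iio i)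

/-- `γ` is upper triangular with respect to the family `w`, with diagonal entries `c`. -/
def IsTriangularOn (w : Fin d → S) (γ : S →ₗ[E] S) (c : Fin d → E) : Prop :=
  ∀ i, γ (w i) - c i • w i ∈ spanBefore E w i

theorem mem_spanBefore {w : Fin d → S} {i j : Fin d} (h : j < i) : w j ∈ spanBefore E w i :=
  Submodule.subset_span ⟨j, h, rfl⟩

theorem spanBefore_mono (w : Fin d → S) : Monotone (spanBefore E w) := fun _ _ h =>
  Submodule.span_mono (Set.image_mono (Set.Iio_subset_Iio h))

namespace IsTriangularOn

variable {w : Fin d → S} {γ δ : S →ₗ[E] S} {c e : Fin d → E}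

theorem map_mem (h : IsTriangularOn w γ c) (i : Fin d) {x : S} (hx : x ∈ spanBefore E w i) :
    γ x ∈ spanBefore E w i := by
  have : spanBefore E w i ≤ (spanBefore E w i).comap γ := by
    refine Submodule.span_le.2 ?_
    rintro _ ⟨j, hj, rfl⟩
    have h1 := spanBefore_mono (E := E) w (le_of_lt hj) (h j)
    simpa using add_mem h1 (Submodule.smul_mem _ (c j) (mem_spanBefore (E := E) (w := w) hj))
  exact this hx

theorem one : IsTriangularOn (E := E) w 1 1 := fun i => by simp

theorem sub (h : IsTriangularOn w γ c) (h' : IsTriangularOn w δ e) :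
    IsTriangularOn w (γ - δ) (c - e) := fun i => by
  have := sub_mem (h i) (h' i)
  simp only [LinearMap.sub_apply, Pi.sub_apply, sub_smul]
  convert this using 1
  abel

theorem mul (h : IsTriangularOn w γ c) (h' : IsTriangularOn w δ e) :
    IsTriangularOn w (γ * δ) (c * e) := fun i => by
  have := add_mem (h.map_mem i (h' i)) (Submodule.smul_mem _ (e i) (h i))
  simp only [Module.End.mul_apply, Pi.mul_apply]
  convert this using 1
  simp only [map_sub, map_smul, smul_sub, smul_smul, mul_comm (e i)]
  abel

theorem pow (h : IsTriangularOn w γ c) (n : ℕ) : IsTriangularOn w (γ ^ n) (c ^ n) := by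
  induction n with
  | zero => simpa using one
  | succ n ih => simpa [pow_succ] using ih.mul h

theorem algebraMap (t : E) : IsTriangularOn w (algebraMap E (Module.End E S) t) (fun _ => t) :=
  fun i => by simp [Module.algebraMap_end_apply]

end IsTriangularOn

/-- The indices at which the partial spans of `w` jump. -/
noncomputable def jumps (E : Type*) {S : Type*} [Field E] [AddCommGroup S] [Module E S] {d : ℕ}
    (w : Fin d → S) : Finset (Fin d) := by
  classical exact {i | w i ∉ spanBefore E w i}

theorem mem_jumps {w : Fin d → S} {i : Fin d} : i ∈ jumps E w ↔ w i ∉ spanBefore E w i := by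
  simp [jumps]

/-- A vector not at a jump is a combination of earlier vectors, to which induction applies. -/
theorem mem_span_jumps (w : Fin d → S) (i : Fin d) :
    w i ∈ Submodule.span E (w '' {j | j ≤ i ∧ j ∈ jumps E w}) := by
  induction i using WellFoundedLT.induction with
  | _ i ih =>
    by_cases h : i ∈ jumps E w
    · exact Submodule.subset_span ⟨i, ⟨le_rfl, h⟩, rfl⟩
    · rw [mem_jumps, not_not] at h
      refine Submodule.span_le.2 ?_ h
      rintro _ ⟨j, hj, rfl⟩
      exact Submodule.span_mono
        (Set.image_mono (Set.ofPred_subset_ofPred.2 fun k hk => ⟨hk.1.trans (le_of_lt hj), hk.2⟩)) (ih j hj)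

theorem spanBefore_eq_span_jumps (w : Fin d → S) (i : Fin d) :
    spanBefore E w i = Submodule.span E (w '' {j | j < i ∧ j ∈ jumps E w}) := by
  refine le_antisymm (Submodule.span_le.2 ?_) 
    (Submodule.span_mono (Set.image_mono fun j (h : _ ∧ _) => h.1))
  rintro _ ⟨j, hj, rfl⟩
  exact Submodule.span_mono (Set.image_mono (Set.ofPred_subset_ofPred.2 fun k hk => ⟨lt_of_le_of_lt hk.1 hj, hk.2⟩))
    (mem_span_jumps w j)

/-- In a nontrivial relation, the last vector with nonzero coefficient would lie in the span of its
predecessors. -/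
theorem linearIndependent_jumps (w : Fin d → S) :
    LinearIndependent E (fun i : jumps E w => w i) := by
  classical
  rw [linearIndependent_iff']
  intro s g hg
  by_contra! hne
  obtain ⟨i₀, hi₀, hgi₀⟩ := hne
  let t := s.filter fun i => g i ≠ 0
  have ht : t.Nonempty := ⟨i₀, Finset.mem_filter.2 ⟨hi₀, hgi₀⟩⟩
  set i := t.max' ht with hi
  have hit := Finset.mem_filter.1 (t.max'_mem ht)
  rw [← hi] at hit
  refine mem_jumps.1 i.2 ?_
  rw [← Submodule.smul_mem_iff _ hit.2]
  rw [← Finset.add_sum_erase s _ hit.1] at hg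
  rw [eq_neg_of_add_eq_zero_left hg]
  refine neg_mem (sum_mem fun j hj => ?_)
  by_cases hgj : g j = 0
  · simp [hgj]
  refine Submodule.smul_mem _ _ (mem_spanBefore ?_)
  have hj' := Finset.mem_erase.1 hj
  exact lt_of_le_of_ne (t.le_max' j (Finset.mem_filter.2 ⟨hj'.2, hgj⟩)) (fun h => hj'.1 (Subtype.ext h))

/-- The vectors at the jumps form a basis of the span. -/
noncomputable def jumpsBasis (w : Fin d → S) (hw : Submodule.span E (Set.range w) = ⊤) :
    Module.Basis (jumps E w) E S :=
  Module.Basis.mk (linearIndependent_jumps w) (by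
    rw [← hw]
    refine Submodule.span_le.2 ?_
    rintro _ ⟨i, rfl⟩
    refine Submodule.span_mono ?_ (mem_span_jumps w i)
    rintro _ ⟨j, hj, rfl⟩
    exact ⟨⟨j, hj.2⟩, rfl⟩)

theorem jumpsBasis_apply (w : Fin d → S) (hw : Submodule.span E (Set.range w) = ⊤)
    (i : jumps E w) : jumpsBasis w hw i = w i := by
  simp [jumpsBasis]

theorem jumpsBasis_repr_eq_zero (w : Fin d → S) (hw : Submodule.span E (Set.range w) = ⊤)
    {i j : jumps E w} (hij : j ≤ i) {x : S} (hx : x ∈ spanBefore E w j) :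
    (jumpsBasis w hw).repr x i = 0 := by
  rw [spanBefore_eq_span_jumps] at hx
  suffices h : Submodule.span E (w '' {k | k < j ∧ k ∈ jumps E w}) ≤
      LinearMap.ker ((jumpsBasis w hw).coord i) from h hx
  refine Submodule.span_le.2 ?_
  rintro _ ⟨k, hk, rfl⟩
  have hne : (⟨k, hk.2⟩ : jumps E w) ≠ i := fun h => by
    have h' : k = i := congrArg Subtype.val h
    exact absurd (lt_of_lt_of_le hk.1 hij) (by rw [h']; exact lt_irrefl _)
  have := jumpsBasis_apply w hw ⟨k, hk.2⟩
  simp only at this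
  simp [← this, hne]

/-- In the basis of jump vectors the matrix is upper triangular: each earlier span is already
spanned by earlier jump vectors, so the redundant vectors of `w` do no harm. -/
theorem IsTriangularOn.det_eq {w : Fin d → S} {γ : S →ₗ[E] S} {c : Fin d → E}
    (h : IsTriangularOn w γ c) (hw : Submodule.span E (Set.range w) = ⊤) :
    LinearMap.det γ = ∏ i ∈ jumps E w, c i := by
  classical
  have key : ∀ i j : jumps E w, j ≤ i →
      LinearMap.toMatrix (jumpsBasis w hw) (jumpsBasis w hw) γ i j =
        if i = j then c j else 0 := by
    intro i j hij
    have h0 := jumpsBasis_repr_eq_zero w hw hij (h j)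
    rw [← jumpsBasis_apply w hw j, map_sub, map_smul, Finsupp.sub_apply, Finsupp.smul_apply,
      Module.Basis.repr_self, Finsupp.single_apply, sub_eq_zero] at h0
    rw [LinearMap.toMatrix_apply, h0]
    by_cases hji : j = i
    · simp [hji]
    · simp [hji, Ne.symm hji]
  rw [← LinearMap.det_toMatrix (jumpsBasis w hw), Matrix.det_of_isUpperTriangular,
    ← Finset.prod_coe_sort (jumps E w) c]
  · exact Finset.prod_congr rfl fun i _ => by rw [key i i le_rfl, if_pos rfl]
  · intro i j hij
    have hij' : j < i := hij
    rw [key i j hij'.le, if_neg hij'.ne']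

/-- The value at t is det(t - γ), and t - γ is triangular with diagonal t - c; over an infinite
field the values determine the polynomial. -/
theorem IsTriangularOn.charpoly_eq [FiniteDimensional E S] [Infinite E]
    {w : Fin d → S} {γ : S →ₗ[E] S} {c : Fin d → E}
    (h : IsTriangularOn w γ c) (hw : Submodule.span E (Set.range w) = ⊤) :
    γ.charpoly = ∏ i ∈ jumps E w, (Polynomial.X - Polynomial.C (c i)) := by
  refine Polynomial.funext fun t => ?_
  rw [LinearMap.eval_charpoly, ((IsTriangularOn.algebraMap t).sub h).det_eq hw]
  simp [Polynomial.eval_prod]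

theorem jumps_eq_univ {w : Fin d → S} (hw : Submodule.span E (Set.range w) = ⊤)
    (hd : Module.finrank E S = d) : jumps E w = Finset.univ := by
  rw [← Finset.card_eq_iff_eq_univ, Fintype.card_fin, ← Fintype.card_coe,
    ← Module.finrank_eq_card_basis (jumpsBasis w hw), hd]

end Triangular

/-! ### Transporting the flag to spaces spanned by an image of G -/

section Transfer

theorem IsCompleteFlag.exists_adapted {F V : Type*} [Field F] [AddCommGroup V] [Module F V]
    {d : ℕ} {W : Fin (d + 1) → Submodule F V} (hW : IsCompleteFlag W) :
    ∃ v : Fin d → V, (∀ i, v i ∈ W i.succ) ∧ (∀ i, spanBefore F v i = W i.castSucc) ∧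
      Submodule.span F (Set.range v) = ⊤ := by
  have hlt : ∀ i : Fin d, ∃ x ∈ W i.succ, x ∉ W i.castSucc := fun i => by
    by_contra! h
    have h1 := le_antisymm (hW.mono (Fin.castSucc_lt_succ (i := i)).le) h
    have h2 := hW.finrank_eq i.succ
    rw [← h1, hW.finrank_eq] at h2
    simp at h2
  choose v hv hv' using hlt
  -- `finrank` is 0 for an infinite-dimensional space, so the positive value i + 1 forces
  -- finiteness.
  have hfin : ∀ i : Fin d, FiniteDimensional F (W i.succ) := fun i =>
    FiniteDimensional.of_finrank_pos (by rw [hW.finrank_eq]; simp)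
  have hsucc : ∀ i : Fin d, W i.succ = W i.castSucc ⊔ Submodule.span F {v i} := fun i => by
    have hle : W i.castSucc ⊔ Submodule.span F {v i} ≤ W i.succ :=
      sup_le (hW.mono (Fin.castSucc_lt_succ (i := i)).le) (by simpa using hv i)
    have := hfin i
    have hfd := Submodule.finiteDimensional_of_le hle
    refine (Submodule.eq_of_le_of_finrank_le hle ?_).symm
    rw [hW.finrank_eq, Fin.val_succ, Nat.succ_le_iff]
    have hlt : W i.castSucc < W i.castSucc ⊔ Submodule.span F {v i} := by
      refine lt_of_le_of_ne le_sup_left fun h => hv' i ?_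
      rw [h]
      exact Submodule.mem_sup_right (Submodule.mem_span_singleton_self _)
    have := Submodule.finrank_lt_finrank_of_lt hlt
    rwa [hW.finrank_eq] at this
  have key : ∀ m : Fin (d + 1), Submodule.span F (v '' {j | j.castSucc < m}) = W m := fun m => by
    induction m using Fin.induction with
    | zero => simp [hW.bot]
    | succ i ih =>
      rw [hsucc, ← ih, ← Submodule.span_union]
      congr 1
      rw [← Set.image_singleton, ← Set.image_union]
      congr 1
      ext j
      simp only [Set.mem_ofPred_eq, Set.mem_union, Set.mem_singleton_iff, Fin.castSucc_lt_succ_iff,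
        Fin.castSucc_lt_castSucc_iff]
      exact le_iff_lt_or_eq
  refine ⟨v, hv, fun i => key i.castSucc, ?_⟩
  rw [← hW.top, ← key, ← Set.image_univ]
  congr 2
  ext j
  simp [Fin.castSucc_lt_last]

/-- A simultaneous triangularisation over `K` of the extensions of `φ` and `ψ` to `ℚ ⊗ G` induces
one on every vector space that is spanned by an equivariant image of `G`. -/
theorem IsJointEigenvalueNumbering.exists_isTriangularOn {G : Type*} [AddCommGroup G]
    {φ ψ : AddMonoid.End G} {K : Type*} [Field K] [Algebra ℚ K] {d : ℕ} {ξ η : Fin d → K}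
    (h : IsJointEigenvalueNumbering (rationalExtension φ) (rationalExtension ψ) ξ η)
    {E S : Type*} [Field E] [AddCommGroup S] [Module E S] (s : K →+* E) (g : G →+ S)
    (hg : Submodule.span E (Set.range g) = ⊤) :
    ∃ (π : Equiv.Perm (Fin d)) (w : Fin d → S), Submodule.span E (Set.range w) = ⊤ ∧
      (∀ φ' : S →ₗ[E] S, (∀ x, φ' (g x) = g (φ x)) →
        IsTriangularOn w φ' (fun i => s (ξ (π i)))) ∧
      (∀ ψ' : S →ₗ[E] S, (∀ x, ψ' (g x) = g (ψ x)) →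
        IsTriangularOn w ψ' (fun i => s (η (π i)))) := by
  obtain ⟨W, π, hW, hact⟩ := h
  obtain ⟨v, hv, hspan, htop⟩ := hW.exists_adapted
  -- Viewing S as a K-space through `s` lets `g` extend K-linearly to K ⊗ ℚ ⊗ G.
  let _ : Module K S := Module.compHom S s
  let _ : Module ℚ S := Module.compHom S (s.comp (algebraMap ℚ K))
  have : IsScalarTower ℚ K S := ⟨fun q a x => by
    change s (q • a) • x = s (algebraMap ℚ K q) • s a • x
    rw [Algebra.smul_def, map_mul, mul_smul]⟩
  have hsmul : ∀ (a : K) (x : S), a • x = s a • x := fun _ _ => rfl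
  let f : K ⊗[ℚ] (ℚ ⊗[ℤ] G) →ₗ[K] S :=
    LinearMap.liftBaseChange K (LinearMap.liftBaseChange ℚ g.toIntLinearMap)
  have hf : ∀ a q x, f (a ⊗ₜ (q ⊗ₜ x)) = a • q • g x := fun _ _ _ => rfl
  -- K-spans are sent only into E-spans. This is all that triangularity needs.
  have hmem : ∀ (A : Set (K ⊗[ℚ] (ℚ ⊗[ℤ] G))) (x), x ∈ Submodule.span K A →
      f x ∈ Submodule.span E (f '' A) := fun A x hx => by
    induction hx using Submodule.span_induction with
    | mem x hx => exact Submodule.subset_span ⟨x, hx, rfl⟩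
    | zero => simp
    | add x y _ _ hx hy => rw [map_add]; exact add_mem hx hy
    | smul a x _ hx => rw [map_smul, hsmul]; exact Submodule.smul_mem _ _ hx
  have htri : ∀ (α : AddMonoid.End G) (c : Fin d → K) (_ : ∀ i : Fin d, ∀ x ∈ W i.succ,
      (rationalExtension α).baseChange K x - c (π i) • x ∈ W i.castSucc) (α' : S →ₗ[E] S),
      (∀ x, α' (g x) = g (α x)) → IsTriangularOn (f ∘ v) α' (fun i => s (c (π i))) := by
    intro α c hc α' hα i
    have hcomm : ∀ x, α' (f x) = f ((rationalExtension α).baseChange K x) := fun x => by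
      induction x with
      | zero => simp
      | add x y hx hy => simp only [map_add, hx, hy]
      | tmul a y =>
        induction y with
        | zero => simp
        | add x y hx hy => simp only [TensorProduct.tmul_add, map_add, hx, hy]
        | tmul q x =>
          rw [LinearMap.baseChange_tmul, rationalExtension, LinearMap.baseChange_tmul, hf, hf]
          change α' (s a • s (algebraMap ℚ K q) • g x) = s a • s (algebraMap ℚ K q) • g (α x)
          rw [map_smul, map_smul, hα]
    have h1 := hc i (v i) (hv i)
    rw [← hspan] at h1
    have h2 := hmem _ _ h1
    rw [map_sub, map_smul, ← hcomm, hsmul, ← Set.image_comp] at h2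
    exact h2
  refine ⟨π, f ∘ v, ?_, htri φ ξ fun i x hx => (hact i x hx).1,
    htri ψ η fun i x hx => (hact i x hx).2⟩
  rw [eq_top_iff, ← hg]
  refine Submodule.span_le.2 ?_
  rintro _ ⟨x, rfl⟩
  have := hmem (Set.range v) (1 ⊗ₜ (1 ⊗ₜ x)) (by rw [htop]; trivial)
  rw [hf, one_smul, one_smul, ← Set.range_comp] at this
  exact this

end Transfer

/-! ### Modules over ℤ_p: Hausdorff quotients and orders of cokernels -/

section PadicModule

open IsLocalRing

variable {p : ℕ} [Fact p.Prime]

/-- This provides the complete source required by `surjective_of_mkQ_comp_surjective`. Limits are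
taken coordinatewise. -/
instance isPrecomplete_pi_padicInt (ι : Type*) :
    IsPrecomplete (maximalIdeal ℤ_[p]) (ι → ℤ_[p]) := by
  refine ⟨fun f hf => ?_⟩
  have hcoord : ∀ i, ∃ L : ℤ_[p], ∀ n,
      f n i ≡ L [SMOD (maximalIdeal ℤ_[p] ^ n • ⊤ : Submodule ℤ_[p] ℤ_[p])] := fun i => by
    refine IsPrecomplete.prec inferInstance fun {m n} hmn => ?_
    have h := hf hmn
    rw [SModEq.sub_mem] at h ⊢
    have h1 := Submodule.mem_map_of_mem (f := LinearMap.proj (R := ℤ_[p]) (φ := fun _ => ℤ_[p]) i) h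
    rw [Submodule.map_smul''] at h1
    exact Submodule.smul_mono le_rfl le_top h1
  choose L hL using hcoord
  refine ⟨L, fun n => ?_⟩
  have hmem : ∀ i, ∃ c, (p : ℤ_[p]) ^ n * c = f n i - L i := fun i => by
    have h := hL i n
    rw [SModEq.sub_mem, smul_eq_mul, Ideal.mul_top, PadicInt.maximalIdeal_eq_span_p,
      Ideal.span_singleton_pow, Ideal.mem_span_singleton] at h
    exact h.imp fun c hc => hc.symm
  choose c hc using hmem
  rw [SModEq.sub_mem, show f n - L = (p : ℤ_[p]) ^ n • c from funext fun i => (hc i).symm,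
    PadicInt.maximalIdeal_eq_span_p, Ideal.span_singleton_pow]
  exact Submodule.smul_mem_smul (Ideal.mem_span_singleton_self _) trivial

variable {N : Type*} [AddCommGroup N] [Module ℤ_[p] N]

/-- The maximal Hausdorff quotient of a flat `ℤ_p`-module of finite rank is finitely generated. -/
theorem finite_hausdorffification [Module.Flat ℤ_[p] N]
    (hrank : Module.rank ℤ_[p] N < Cardinal.aleph0) :
    Module.Finite ℤ_[p] (Hausdorffification (maximalIdeal ℤ_[p]) N) := by
  let b := Module.Basis.ofVectorSpace (ResidueField ℤ_[p]) (ResidueField ℤ_[p] ⊗[ℤ_[p]] N)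
  obtain ⟨v, hv⟩ := (TensorProduct.mk_surjective ℤ_[p] N (ResidueField ℤ_[p])
    Ideal.Quotient.mk_surjective).comp_left b
  -- By flatness, lifts of a basis of N/pN are independent over ℤ_p, so the rank bound makes the
  -- basis finite.
  have hli : LinearIndependent ℤ_[p] v :=
    Module.IsLocalRing.linearIndependent_of_flat v (by
      have hv' : TensorProduct.mk ℤ_[p] (ResidueField ℤ_[p]) N 1 ∘ v = b := hv
      rw [hv']
      exact b.linearIndependent)
  have hfin : Finite (Module.Basis.ofVectorSpaceIndex (ResidueField ℤ_[p])
      (ResidueField ℤ_[p] ⊗[ℤ_[p]] N)) := by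
    rw [← Cardinal.lt_aleph0_iff_finite]
    exact hli.cardinal_le_rank.trans_lt hrank
  have := Fintype.ofFinite (Module.Basis.ofVectorSpaceIndex (ResidueField ℤ_[p])
      (ResidueField ℤ_[p] ⊗[ℤ_[p]] N))
  -- The lifts generate modulo p; completeness of ℤ_pᵐ and separatedness of the target upgrade this
  -- to surjectivity.
  let f := Hausdorffification.of (maximalIdeal ℤ_[p]) N ∘ₗ Fintype.linearCombination ℤ_[p] v
  refine Module.Finite.of_surjective f
    (surjective_of_mkQ_comp_surjective (I := maximalIdeal ℤ_[p]) fun y => ?_)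
  obtain ⟨y, rfl⟩ := Submodule.mkQ_surjective _ y
  obtain ⟨x, rfl⟩ := Submodule.mkQ_surjective _ y
  choose r hr using fun i => residue_surjective (b.repr (1 ⊗ₜ x) i)
  refine ⟨r, ?_⟩
  have hx : x - ∑ i, r i • v i ∈ maximalIdeal ℤ_[p] • (⊤ : Submodule ℤ_[p] N) := by
    rw [← LinearMap.ker_tensorProductMk, LinearMap.mem_ker, map_sub, sub_eq_zero, map_sum]
    refine (b.sum_repr (1 ⊗ₜ x)).symm.trans (Finset.sum_congr rfl fun i _ => ?_)
    rw [← hr i, map_smul, ← congrFun hv i]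
    rfl
  refine ((Submodule.Quotient.eq _).2 ?_).symm
  have h1 := Submodule.mem_map_of_mem (f := Hausdorffification.of (maximalIdeal ℤ_[p]) N) hx
  rw [Submodule.map_smul'', map_sub] at h1
  exact Submodule.smul_mono le_rfl le_top h1

theorem mem_iInf_maximalIdeal_pow_smul_iff {x : N} :
    x ∈ (⨅ n : ℕ, maximalIdeal ℤ_[p] ^ n • ⊤ : Submodule ℤ_[p] N) ↔
      ∀ n : ℕ, ∃ y, x = (p : ℤ_[p]) ^ n • y := by
  rw [Submodule.mem_iInf]
  refine forall_congr' fun n => ?_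
  rw [PadicInt.maximalIdeal_eq_span_p, Ideal.span_singleton_pow,
    Submodule.ideal_span_singleton_smul, Submodule.mem_smul_pointwise_iff_exists]
  simp [eq_comm]

theorem PadicInt.inv_unitCoeff_mul {r : ℤ_[p]} (hr : r ≠ 0) :
    ((PadicInt.unitCoeff hr)⁻¹ : ℤ_[p]ˣ) * r = (p : ℤ_[p]) ^ r.valuation := by
  rw [Units.inv_mul_eq_iff_eq_mul]
  exact PadicInt.unitCoeff_spec hr

/-- With r a unit times p^v, if r • x is divisible by p^(n+v) then cancelling r leaves x divisible
by pⁿ. -/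
theorem isTorsionFree_hausdorffification [Module.IsTorsionFree ℤ_[p] N] :
    Module.IsTorsionFree ℤ_[p] (Hausdorffification (maximalIdeal ℤ_[p]) N) := by
  refine Module.IsTorsionFree.of_smul_eq_zero fun r y hy => ?_
  obtain ⟨x, rfl⟩ := Submodule.mkQ_surjective _ y
  rw [or_iff_not_imp_left]
  intro hr
  rw [← map_smul, Submodule.mkQ_apply, Submodule.Quotient.mk_eq_zero,
    mem_iInf_maximalIdeal_pow_smul_iff] at hy
  rw [Submodule.mkQ_apply, Submodule.Quotient.mk_eq_zero, mem_iInf_maximalIdeal_pow_smul_iff]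
  intro n
  obtain ⟨y, hy⟩ := hy (n + r.valuation)
  let u := PadicInt.unitCoeff hr
  refine ⟨((u⁻¹ : ℤ_[p]ˣ) : ℤ_[p]) • y, smul_right_injective N hr ?_⟩
  change r • x = r • (p : ℤ_[p]) ^ n • ((u⁻¹ : ℤ_[p]ˣ) : ℤ_[p]) • y
  rw [hy, smul_smul, smul_smul, pow_add, ← PadicInt.inv_unitCoeff_mul hr]
  congr 1
  ring

/-- `‖a‖⁻¹` is the order of `ℤ_p / a`. -/
theorem card_padicInt_quotient_span (a : ℤ_[p]) (ha : a ≠ 0) :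
    (Nat.card (ℤ_[p] ⧸ Ideal.span {a}) : ℝ) = ‖a‖⁻¹ := by
  have h : Ideal.span {a} = RingHom.ker (PadicInt.toZModPow (p := p) a.valuation) := by
    rw [PadicInt.ker_toZModPow, Ideal.span_singleton_eq_span_singleton]
    conv_lhs => rw [PadicInt.unitCoeff_spec ha]
    exact associated_unit_mul_left _ _ (Units.isUnit _)
  rw [h, Nat.card_congr (RingHom.quotientKerEquivOfSurjective
    (ZMod.ringHom_surjective (PadicInt.toZModPow (p := p) a.valuation))).toEquiv, Nat.card_zmod,
    PadicInt.norm_eq_zpow_neg_valuation ha]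
  simp

/-- In Smith normal form the cokernel is a product of cyclic modules ℤ_p / aᵢ, and det A is ∏ aᵢ up
to a unit, which has norm 1. -/
theorem card_quotient_range_eq_norm_det [Module.Free ℤ_[p] N] [Module.Finite ℤ_[p] N]
    (A : N →ₗ[ℤ_[p]] N) (hA : LinearMap.det A ≠ 0) :
    (Nat.card (N ⧸ LinearMap.range A) : ℝ) = ‖LinearMap.det A‖⁻¹ := by
  classical
  have hinj : Function.Injective A := by
    rw [← LinearMap.ker_eq_bot]
    by_contra h
    exact hA (LinearMap.det_eq_zero_iff_ker_ne_bot.2 h)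
  let b := Module.Free.chooseBasis ℤ_[p] N
  let eA := LinearEquiv.ofInjective A hinj
  have h : Module.finrank ℤ_[p] (LinearMap.range A) = Module.finrank ℤ_[p] N := eA.symm.finrank_eq
  let a := Submodule.smithNormalFormCoeffs b h
  let b' := Submodule.smithNormalFormTopBasis b h
  let ab := Submodule.smithNormalFormBotBasis b h
  let e := b'.equiv ab (Equiv.refl _)
  have hdiag : LinearMap.toMatrix b' b' ((LinearMap.range A).subtype ∘ₗ e.toLinearMap) =
      Matrix.diagonal a := by
    ext i j
    rw [LinearMap.toMatrix_apply]
    have : ((LinearMap.range A).subtype ∘ₗ e.toLinearMap) (b' j) = a j • b' j := by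
      simp [e, ab, a, b', Submodule.smithNormalFormBotBasis_def b h j]
    rw [this, map_smul, Module.Basis.repr_self, Finsupp.smul_single, smul_eq_mul, mul_one]
    by_cases hij : i = j
    · rw [hij, Matrix.diagonal_apply_eq, Finsupp.single_eq_same]
    · rw [Matrix.diagonal_apply_ne _ hij, Finsupp.single_eq_of_ne hij]
  have hassoc : ‖LinearMap.det A‖ = ‖∏ i, a i‖ := by
    rw [← Matrix.det_diagonal, ← hdiag, LinearMap.det_toMatrix]
    have := LinearMap.associated_det_comp_equiv (LinearMap.range A).subtype eA e
    obtain ⟨u, hu⟩ := this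
    rw [← hu, norm_mul, PadicInt.norm_units, mul_one]
    rfl
  rw [Nat.card_congr (Submodule.quotientEquivPiSpan (LinearMap.range A) b h).toEquiv, Nat.card_pi,
    Nat.cast_prod, hassoc, norm_prod, ← Finset.prod_inv_distrib]
  exact Finset.prod_congr rfl fun i _ =>
    card_padicInt_quotient_span _ (Submodule.smithNormalFormCoeffs_ne_zero b h i)

/-- For B a product of cyclic groups ℤ/nᵢ, the tensor product is the product of the ℤ_p / nᵢ. -/
theorem card_padicInt_tensor {B : Type*} [AddCommGroup B] [Finite B] :
    (Nat.card (ℤ_[p] ⊗[ℤ] B) : ℝ) = ‖(Nat.card B : ℤ_[p])‖⁻¹ := by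
  classical
  obtain ⟨ι, _, n, hn, ⟨e⟩⟩ := AddCommGroup.equiv_directSum_zmod_of_finite' B
  let e' : B ≃ₗ[ℤ] ∀ i, ℤ ⧸ Ideal.span {(n i : ℤ)} :=
    (e.trans (DirectSum.addEquivProd _)).toIntLinearEquiv.trans
      (LinearEquiv.piCongrRight fun i =>
        (Int.quotientSpanNatEquivZMod (n i)).symm.toAddEquiv.toIntLinearEquiv)
  have hB : Nat.card B = ∏ i, n i := by
    rw [Nat.card_congr e'.toEquiv, Nat.card_pi]
    exact Finset.prod_congr rfl fun i _ => by
      rw [Nat.card_congr (Int.quotientSpanNatEquivZMod (n i)).toEquiv, Nat.card_zmod]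
  rw [hB, Nat.card_congr ((TensorProduct.congr (LinearEquiv.refl ℤ ℤ_[p]) e').trans
      (TensorProduct.piRight ℤ ℤ ℤ_[p] _)).toEquiv, Nat.card_pi, Nat.cast_prod, Nat.cast_prod,
    norm_prod, ← Finset.prod_inv_distrib]
  refine Finset.prod_congr rfl fun i _ => ?_
  rw [← card_padicInt_quotient_span _ (by exact_mod_cast (zero_lt_one.trans (hn i)).ne'),
    Nat.card_congr (TensorProduct.tensorQuotEquivQuotSMul ℤ_[p] (Ideal.span {(n i : ℤ)})).toEquiv]
  rw [Nat.cast_inj]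
  refine Nat.card_congr (Quotient.congrRight fun x y => ?_)
  rw [Submodule.quotientRel_def, Submodule.quotientRel_def, Ideal.mem_span_singleton,
    Submodule.ideal_span_singleton_smul, Submodule.mem_smul_pointwise_iff_exists]
  simp [dvd_def, eq_comm]

/-! ### The p-adic hull of G -/

variable (p) in
/-- The `p`-adic completion of `G`, as a quotient of `ℤ_p ⊗ G`. -/
abbrev padicHull (G : Type*) [AddCommGroup G] : Type _ :=
  Hausdorffification (maximalIdeal ℤ_[p]) (ℤ_[p] ⊗[ℤ] G)

namespace padicHull

variable {G : Type*} [AddCommGroup G]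

variable (p G) in
/-- The canonical map of `G` to its `p`-adic hull. -/
noncomputable def of : G →+ padicHull p G :=
  ((Hausdorffification.of (maximalIdeal ℤ_[p]) (ℤ_[p] ⊗[ℤ] G)).restrictScalars ℤ ∘ₗ
    TensorProduct.mk ℤ ℤ_[p] G 1).toAddMonoidHom

theorem of_apply (x : G) :
    of p G x = Hausdorffification.of (maximalIdeal ℤ_[p]) (ℤ_[p] ⊗[ℤ] G) (1 ⊗ₜ x) := rfl

theorem mk_tmul (a : ℤ_[p]) (x : G) :
    Hausdorffification.of (maximalIdeal ℤ_[p]) (ℤ_[p] ⊗[ℤ] G) (a ⊗ₜ x) = a • of p G x := by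
  rw [of_apply, ← map_smul, TensorProduct.smul_tmul', smul_eq_mul, mul_one]

variable (p G) in
theorem span_range_of : Submodule.span ℤ_[p] (Set.range (of p G)) = ⊤ := by
  refine eq_top_iff.2 fun y _ => ?_
  obtain ⟨y, rfl⟩ := Submodule.mkQ_surjective _ y
  induction y with
  | zero => simp
  | add x y hx hy => rw [map_add]; exact add_mem (hx trivial) (hy trivial)
  | tmul a x =>
    have h : (Submodule.mkQ _) (a ⊗ₜ x) = a • of p G x := mk_tmul a x
    rw [h]
    exact Submodule.smul_mem _ _ (Submodule.subset_span ⟨x, rfl⟩)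

instance [IsAddTorsionFree G] : Module.Flat ℤ_[p] (ℤ_[p] ⊗[ℤ] G) := by
  have : Module.Flat ℤ G := by infer_instance
  infer_instance

/-- The `p`-adic hull of a torsion-free group of finite rank is a finitely generated module. -/
theorem finite [IsAddTorsionFree G] [FiniteDimensional ℚ (ℚ ⊗[ℤ] G)] :
    Module.Finite ℤ_[p] (padicHull p G) := by
  refine finite_hausdorffification ?_
  -- The rank is bounded by embedding into ℚ_p ⊗ G, which is the base change of ℚ ⊗ G.
  let f : ℤ_[p] ⊗[ℤ] G →ₗ[ℤ_[p]] ℚ_[p] ⊗[ℤ] G :=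
    TensorProduct.AlgebraTensorModule.map (Algebra.linearMap ℤ_[p] ℚ_[p]) LinearMap.id
  have hf : Function.Injective f :=
    Module.Flat.rTensor_preserves_injective_linearMap (M := G)
      ((Algebra.linearMap ℤ_[p] ℚ_[p]).restrictScalars ℤ) (IsFractionRing.injective ℤ_[p] ℚ_[p])
  refine (LinearMap.rank_le_of_injective f hf).trans_lt ?_
  have e := TensorProduct.AlgebraTensorModule.cancelBaseChange ℤ ℚ ℚ_[p] ℚ_[p] G
  have : FiniteDimensional ℚ_[p] (ℚ_[p] ⊗[ℤ] G) := Module.Finite.equiv e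
  rw [← IsFractionRing.rank_right_eq ℤ_[p] ℚ_[p]]
  exact Module.rank_lt_aleph0 _ _

theorem free [IsAddTorsionFree G] [FiniteDimensional ℚ (ℚ ⊗[ℤ] G)] :
    Module.Free ℤ_[p] (padicHull p G) := by
  have := finite (p := p) (G := G)
  have := isTorsionFree_hausdorffification (p := p) (N := ℤ_[p] ⊗[ℤ] G)
  exact Module.free_of_finite_type_torsion_free'

/-- The endomorphism of the `p`-adic hull induced by an endomorphism of `G`. -/
noncomputable def map (φ : AddMonoid.End G) : padicHull p G →ₗ[ℤ_[p]] padicHull p G :=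
  Hausdorffification.lift (maximalIdeal ℤ_[p])
    (Hausdorffification.of (maximalIdeal ℤ_[p]) (ℤ_[p] ⊗[ℤ] G) ∘ₗ
      (AddMonoidHom.toIntLinearMap φ).baseChange ℤ_[p])

theorem map_of (φ : AddMonoid.End G) (x : G) : map φ (of p G x) = of p G (φ x) := rfl

/-- The maps from ℤ_p ⊗ G onto ℤ_p ⊗ G/AG and onto the cokernel on the hull have the same kernel:
infinitely p-divisible elements vanish in a module killed by |G/AG|. -/
theorem card_quotient_range (A : G →ₗ[ℤ] G) [Finite (G ⧸ LinearMap.range A)]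
    (A' : padicHull p G →ₗ[ℤ_[p]] padicHull p G) (h : ∀ x, A' (of p G x) = of p G (A x)) :
    (Nat.card (padicHull p G ⧸ LinearMap.range A') : ℝ) =
      ‖(Nat.card (G ⧸ LinearMap.range A) : ℤ_[p])‖⁻¹ := by
  let B := G ⧸ LinearMap.range A
  let q := Hausdorffification.of (maximalIdeal ℤ_[p]) (ℤ_[p] ⊗[ℤ] G)
  let f₁ : ℤ_[p] ⊗[ℤ] G →ₗ[ℤ_[p]] ℤ_[p] ⊗[ℤ] B := (LinearMap.range A).mkQ.baseChange ℤ_[p]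
  let f₂ : ℤ_[p] ⊗[ℤ] G →ₗ[ℤ_[p]] padicHull p G ⧸ LinearMap.range A' :=
    (LinearMap.range A').mkQ ∘ₗ q
  have hq : Function.Surjective q := Submodule.mkQ_surjective _
  have hf₁ : Function.Surjective f₁ :=
    LinearMap.lTensor_surjective ℤ_[p] (Submodule.mkQ_surjective (LinearMap.range A))
  have hf₂ : Function.Surjective f₂ := (Submodule.mkQ_surjective _).comp hq
  have hcomm : ∀ x, A' (q x) = q (A.baseChange ℤ_[p] x) := fun x => by
    induction x with
    | zero => simp
    | add x y hx hy => simp only [map_add, hx, hy]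
    | tmul a x => rw [LinearMap.baseChange_tmul, mk_tmul, mk_tmul, map_smul, h]
  have hexact : Function.Exact (A.baseChange ℤ_[p]) f₁ :=
    lTensor_exact ℤ_[p] (LinearMap.exact_map_mkQ_range A) (Submodule.mkQ_surjective _)
  have hkill : ∀ t : ℤ_[p] ⊗[ℤ] B, (Nat.card B : ℤ_[p]) • t = 0 := fun t => by
    induction t with
    | zero => simp
    | add x y hx hy => rw [smul_add, hx, hy, add_zero]
    | tmul a x =>
      rw [Nat.cast_smul_eq_nsmul, TensorProduct.smul_tmul', TensorProduct.smul_tmul,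
        card_nsmul_eq_zero', TensorProduct.tmul_zero]
  have hB : (Nat.card B : ℤ_[p]) ≠ 0 := Nat.cast_ne_zero.2 Nat.card_pos.ne'
  -- Divisibility by p^v suffices, v being the valuation of |B|, because p^v is a unit times |B|.
  have hD : ∀ x, q x = 0 → f₁ x = 0 := fun x hx => by
    obtain ⟨y, rfl⟩ := mem_iInf_maximalIdeal_pow_smul_iff.1
      ((Submodule.Quotient.mk_eq_zero _).1 hx) (Nat.card B : ℤ_[p]).valuation
    rw [map_smul, ← PadicInt.inv_unitCoeff_mul hB, mul_smul, hkill, smul_zero]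
  have hker : LinearMap.ker f₁ = LinearMap.ker f₂ := by
    ext x
    rw [LinearMap.mem_ker, LinearMap.mem_ker, LinearMap.comp_apply, Submodule.mkQ_apply,
      Submodule.Quotient.mk_eq_zero]
    constructor
    · intro hx
      obtain ⟨y, rfl⟩ := (hexact x).1 hx
      exact ⟨q y, hcomm y⟩
    · rintro ⟨y, hy⟩
      obtain ⟨y, rfl⟩ := hq y
      rw [hcomm, eq_comm, ← sub_eq_zero, ← map_sub] at hy
      have h1 := hD _ hy
      rwa [map_sub, hexact.apply_apply_eq_zero, sub_zero] at h1
  rw [← card_padicInt_tensor, ← Nat.card_congr (f₁.quotKerEquivOfSurjective hf₁).toEquiv, hker,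
    Nat.card_congr (f₂.quotKerEquivOfSurjective hf₂).toEquiv]

end padicHull

end PadicModule

/-! ### The product formula over ℚ -/

section ProductFormula

theorem finite_primes_norm_natCast_ne_one {n : ℕ} (hn : n ≠ 0) :
    {p : Nat.Primes | ‖(n : ℚ_[p])‖ ≠ 1}.Finite := by
  refine Set.Finite.of_finite_image (f := fun p : Nat.Primes => (p : ℕ))
    (n.primeFactors.finite_toSet.subset ?_) Subtype.val_injective.injOn
  rintro _ ⟨p, hp, rfl⟩
  refine Finset.mem_coe.2 (Nat.mem_primeFactors.2 ⟨p.2, ?_, hn⟩)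
  by_contra h
  exact hp (Padic.norm_natCast_eq_one_iff.2 ((Nat.Prime.coprime_iff_not_dvd p.2).2 h))

theorem finprod_norm_natCast_inv {n : ℕ} (hn : n ≠ 0) :
    ∏ᶠ p : Nat.Primes, ‖(n : ℚ_[p])‖⁻¹ = n := by
  have h : ∀ p : Nat.Primes, ‖(n : ℚ_[p])‖⁻¹ = (((p : ℕ) ^ n.factorization p : ℕ) : ℝ) :=
    fun p => by
      rw [Padic.norm_eq_zpow_neg_valuation (Nat.cast_ne_zero.2 hn), Padic.valuation_natCast,
        zpow_neg, inv_inv, zpow_natCast, Nat.factorization_def n p.2, Nat.cast_pow]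
  have hsub : (Function.mulSupport fun p : Nat.Primes => ‖(n : ℚ_[p])‖⁻¹) ⊆
      (show Finset Nat.Primes from n.primeFactors.subtype Nat.Prime : Finset Nat.Primes) := by
    intro p hp
    rw [Function.mem_mulSupport, h] at hp
    refine Finset.mem_coe.2 (Finset.mem_subtype.2 ?_)
    rw [← Nat.support_factorization, Finsupp.mem_support_iff]
    exact fun h0 => hp (by rw [h0, pow_zero, Nat.cast_one])
  rw [finprod_eq_prod_of_mulSupport_subset _ hsub, Finset.prod_congr rfl fun p _ => h p]
  refine (Finset.prod_subtype_of_mem (fun p => ((p ^ n.factorization p : ℕ) : ℝ))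
    fun p hp => (Nat.mem_primeFactors.1 hp).1).trans ?_
  rw [← Nat.cast_prod]
  exact congrArg Nat.cast (Nat.prod_factorization_pow_eq_self hn)

/-- The product formula for rational numbers. -/
theorem Rat.abs_mul_finprod_norm_eq_one {q : ℚ} (hq : q ≠ 0) :
    |(q : ℝ)| * ∏ᶠ p : Nat.Primes, ‖(q : ℚ_[p])‖ = 1 := by
  have hnum : q.num.natAbs ≠ 0 := by simpa using hq
  have h : ∀ p : Nat.Primes, ‖(q : ℚ_[p])‖ = ‖(q.den : ℚ_[p])‖⁻¹ / ‖(q.num.natAbs : ℚ_[p])‖⁻¹ := by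
    intro p
    have h1 : ‖(q.num.natAbs : ℚ_[p])‖ = ‖(q.num : ℚ_[p])‖ := by
      rcases Int.natAbs_eq q.num with h | h
      · conv_rhs => rw [h, Int.cast_natCast]
      · conv_rhs => rw [h, Int.cast_neg, norm_neg, Int.cast_natCast]
    rw [div_inv_eq_mul, h1, mul_comm, ← div_eq_mul_inv, ← norm_div, ← Rat.cast_def]
  have hsupp : ∀ {n : ℕ}, n ≠ 0 →
      (Function.mulSupport fun p : Nat.Primes => ‖(n : ℚ_[p])‖⁻¹).Finite := fun hn =>
    (finite_primes_norm_natCast_ne_one hn).subset fun p hp h => hp (by simp [h])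
  simp_rw [h]
  rw [finprod_div_distrib (hsupp q.den_nz) (hsupp hnum), finprod_norm_natCast_inv q.den_nz,
    finprod_norm_natCast_inv hnum, Nat.cast_natAbs, Int.cast_abs]
  nth_rewrite 1 [Rat.cast_def]
  have h1 : (q.num : ℝ) ≠ 0 := by simpa using hq
  have h2 : (q.den : ℝ) ≠ 0 := by simp
  rw [abs_div, Nat.abs_cast]
  field_simp

end ProductFormula

/-! ### Integrality and norms of algebraic numbers at almost all primes -/

section Integrality

/-- If ‖x‖ > 1, the leading term of a monic equation strictly dominates all others in the
ultrametric norm, so the terms cannot cancel. -/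
theorem PadicAlgCl.norm_le_one_of_isIntegral {p : ℕ} [Fact p.Prime] {x : PadicAlgCl p}
    (hx : IsIntegral ℤ_[p] x) : ‖x‖ ≤ 1 := by
  obtain ⟨f, hf, hfx⟩ := hx
  by_contra! h
  have hcoe : ∀ a : ℤ_[p], ‖algebraMap ℤ_[p] (PadicAlgCl p) a‖ ≤ 1 := fun a => by
    rw [IsScalarTower.algebraMap_apply ℤ_[p] ℚ_[p] (PadicAlgCl p)]
    exact (PadicAlgCl.norm_extends p _).trans_le a.2
  rw [Polynomial.eval₂_eq_sum_range, Finset.sum_range_succ, hf.coeff_natDegree, map_one, one_mul,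
    add_comm] at hfx
  have hx := eq_neg_of_add_eq_zero_left hfx
  have h1 : ‖∑ i ∈ Finset.range f.natDegree, algebraMap ℤ_[p] (PadicAlgCl p) (f.coeff i) * x ^ i‖ <
      ‖x‖ ^ f.natDegree := by
    have h0 := zero_lt_one.trans h
    refine (IsUltrametricDist.norm_sum_le_of_forall_le_of_nonneg
      (C := ‖x‖ ^ f.natDegree / ‖x‖) (by positivity) fun i hi => ?_).trans_lt
      (div_lt_self (pow_pos h0 _) h)
    rw [norm_mul, norm_pow, le_div_iff₀ h0]
    refine (mul_le_mul_of_nonneg_right (mul_le_of_le_one_left (by positivity) (hcoe _))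
      h0.le).trans ?_
    rw [← pow_succ]
    exact pow_le_pow_right₀ h.le (Finset.mem_range.1 hi)
  rw [← norm_neg, ← hx, norm_pow] at h1
  exact lt_irrefl _ h1

/-- Some nonzero integer multiple y x is integral, so norm > 1 is possible only at primes dividing
y, whatever the embeddings. -/
theorem finite_primes_one_lt_norm {F : Type*} [Field F] [CharZero F] {x : F} (hx : IsAlgebraic ℤ x)
    (σ : ∀ p : Nat.Primes, F →+* PadicAlgCl p) : {p : Nat.Primes | 1 < ‖σ p x‖}.Finite := by
  obtain ⟨y, hy, hint⟩ := hx.exists_integral_multiple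
  refine (finite_primes_norm_natCast_ne_one (Int.natAbs_ne_zero.2 hy)).subset fun p hp h => ?_
  have h1 := PadicAlgCl.norm_le_one_of_isIntegral ((hint.map (σ p).toIntAlgHom).tower_top (A := ℤ_[p]))
  have h2 : ‖(y : PadicAlgCl p)‖ = 1 := by
    rw [← h, ← PadicAlgCl.norm_extends, map_natCast]
    rcases Int.natAbs_eq y with h | h
    · conv_lhs => rw [h, Int.cast_natCast]
    · conv_lhs => rw [h, Int.cast_neg, norm_neg, Int.cast_natCast]
  rw [zsmul_eq_mul, map_mul, map_intCast, norm_mul, h2, one_mul] at h1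
  exact absurd hp (not_lt.2 h1)

theorem finite_primes_norm_ne_one {F : Type*} [Field F] [CharZero F] {x : F} (hx : IsAlgebraic ℤ x)
    (hx0 : x ≠ 0) (σ : ∀ p : Nat.Primes, F →+* PadicAlgCl p) :
    {p : Nat.Primes | ‖σ p x‖ ≠ 1}.Finite := by
  refine ((finite_primes_one_lt_norm hx σ).union
    (finite_primes_one_lt_norm hx.inv σ)).subset fun p hp => ?_
  rcases lt_or_gt_of_ne hp with h | h
  · refine Or.inr ?_
    rw [Set.mem_ofPred_eq, map_inv₀, norm_inv]
    exact (one_lt_inv₀ (norm_pos_iff.2 (by simpa using hx0))).2 h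
  · exact Or.inl h

end Integrality

/-! ### Cokernels, determinants and the local index sets -/

section Reidemeister

/-- The Reidemeister classes are the cosets of the image of `φ - ψ`. -/
theorem reidemeisterNumber_eq {G : Type*} [AddCommGroup G] (φ ψ : AddMonoid.End G) :
    reidemeisterNumber φ ψ =
      ENat.card (G ⧸ LinearMap.range (AddMonoidHom.toIntLinearMap (φ - ψ))) := by
  refine ENat.card_congr (Quotient.congrRight fun x y => ?_)
  rw [Submodule.quotientRel_def]
  change (∃ g : G, x = -(φ g) + y + ψ g) ↔ ∃ g : G, φ g - ψ g = x - y
  constructor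
  · rintro ⟨g, hg⟩
    exact ⟨-g, by rw [hg, map_neg, map_neg]; abel⟩
  · rintro ⟨g, hg⟩
    exact ⟨-g, by rw [map_neg, map_neg, eq_add_of_sub_eq hg.symm]; abel⟩

/-- The image of A contains |B| • x for every x, and |B| is invertible in ℚ. -/
theorem rationalExtension_surjective {G : Type*} [AddCommGroup G] (A : AddMonoid.End G)
    [Finite (G ⧸ LinearMap.range (AddMonoidHom.toIntLinearMap A))] :
    Function.Surjective (rationalExtension A) := by
  set B := G ⧸ LinearMap.range (AddMonoidHom.toIntLinearMap A) with hB
  intro v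
  induction v with
  | zero => exact ⟨0, map_zero _⟩
  | add x y hx hy =>
    obtain ⟨x, rfl⟩ := hx
    obtain ⟨y, rfl⟩ := hy
    exact ⟨x + y, map_add _ _ _⟩
  | tmul q x =>
    have h : Nat.card B • x ∈ LinearMap.range (AddMonoidHom.toIntLinearMap A) := by
      rw [← Submodule.Quotient.mk_eq_zero, Submodule.Quotient.mk_smul]
      exact card_nsmul_eq_zero'
    obtain ⟨y, hy⟩ := h
    refine ⟨(q / Nat.card B) ⊗ₜ y, ?_⟩
    rw [rationalExtension, LinearMap.baseChange_tmul, hy, ← TensorProduct.smul_tmul,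
      nsmul_eq_mul, mul_div_cancel₀ _ (Nat.cast_ne_zero.2 Nat.card_pos.ne')]

theorem det_rationalExtension_ne_zero {G : Type*} [AddCommGroup G]
    [FiniteDimensional ℚ (ℚ ⊗[ℤ] G)] (A : AddMonoid.End G)
    [Finite (G ⧸ LinearMap.range (AddMonoidHom.toIntLinearMap A))] :
    LinearMap.det (rationalExtension A) ≠ 0 := by
  intro h
  have := rationalExtension_surjective A
  rw [← LinearMap.range_eq_top, ← LinearMap.ker_eq_bot_iff_range_eq_top] at this
  exact LinearMap.det_eq_zero_iff_ker_ne_bot.1 h this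

/-- One index set, the jumps renumbered by π, serves both endomorphisms and every n. It is used over
K, where it is everything, and over ℚ̄_p, where it defines I(p). -/
theorem IsJointEigenvalueNumbering.exists_indices {G : Type*} [AddCommGroup G]
    {φ ψ : AddMonoid.End G} {K : Type*} [Field K] [Algebra ℚ K] {d : ℕ} {ξ η : Fin d → K}
    (h : IsJointEigenvalueNumbering (rationalExtension φ) (rationalExtension ψ) ξ η)
    {E S : Type*} [Field E] [Infinite E] [AddCommGroup S] [Module E S] [FiniteDimensional E S]
    (s : K →+* E) (g : G →+ S) (hg : Submodule.span E (Set.range g) = ⊤) (φ' ψ' : S →ₗ[E] S)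
    (hφ : ∀ x, φ' (g x) = g (φ x)) (hψ : ∀ x, ψ' (g x) = g (ψ x)) :
    ∃ I : Finset (Fin d),
      φ'.charpoly = ∏ i ∈ I, (Polynomial.X - Polynomial.C (s (ξ i))) ∧
      ψ'.charpoly = ∏ i ∈ I, (Polynomial.X - Polynomial.C (s (η i))) ∧
      (Module.finrank E S = d → I = Finset.univ) ∧
      ∀ (n : ℕ) (A : S →ₗ[E] S), (∀ x, A (g x) = g ((φ ^ n - ψ ^ n) x)) →
        LinearMap.det A = ∏ i ∈ I, (s (ξ i) ^ n - s (η i) ^ n) := by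
  obtain ⟨π, w, hw, h1, h2⟩ := h.exists_isTriangularOn s g hg
  have htφ := h1 φ' hφ
  have htψ := h2 ψ' hψ
  have hpow : ∀ (α : AddMonoid.End G) (α' : S →ₗ[E] S), (∀ x, α' (g x) = g (α x)) →
      ∀ (n : ℕ) x, (α' ^ n) (g x) = g ((α ^ n) x) := fun α α' hα n => by
    induction n with
    | zero => exact fun x => rfl
    | succ n ih =>
      intro x
      rw [pow_succ, pow_succ, Module.End.mul_apply, hα, ih]
      rfl
  refine ⟨(jumps E w).map π.toEmbedding, ?_, ?_, fun hd => ?_, fun n A hA => ?_⟩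
  · rw [htφ.charpoly_eq hw, Finset.prod_map]; rfl
  · rw [htψ.charpoly_eq hw, Finset.prod_map]; rfl
  · rw [jumps_eq_univ hw hd, Finset.map_univ_equiv]
  -- A linear map is determined by its values on the spanning image of G.
  · have hAeq : A = φ' ^ n - ψ' ^ n := by
      refine LinearMap.ext_on_range hg fun x => ?_
      rw [hA, LinearMap.sub_apply, hpow φ φ' hφ, hpow ψ ψ' hψ, ← map_sub]
      rfl
    rw [hAeq, ((htφ.pow n).sub (htψ.pow n)).det_eq hw, Finset.prod_map]
    rfl

/-- The determinant of the extension of `φⁿ - ψⁿ` to `ℚ ⊗ G` in terms of the eigenvalues. -/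
theorem IsJointEigenvalueNumbering.det_eq {G : Type*} [AddCommGroup G]
    [FiniteDimensional ℚ (ℚ ⊗[ℤ] G)]
    {φ ψ : AddMonoid.End G} {K : Type*} [Field K] [Algebra ℚ K] {d : ℕ} {ξ η : Fin d → K}
    (h : IsJointEigenvalueNumbering (rationalExtension φ) (rationalExtension ψ) ξ η) (n : ℕ) :
    algebraMap ℚ K (LinearMap.det (rationalExtension (φ ^ n - ψ ^ n))) =
      ∏ i, (ξ i ^ n - η i ^ n) := by
  have : CharZero K := algebraRat.charZero K
  let g : G →+ K ⊗[ℚ] (ℚ ⊗[ℤ] G) :=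
    ((TensorProduct.mk ℚ K (ℚ ⊗[ℤ] G) 1).restrictScalars ℤ ∘ₗ
      TensorProduct.mk ℤ ℚ G 1).toAddMonoidHom
  have hgx : ∀ x, g x = 1 ⊗ₜ (1 ⊗ₜ x) := fun _ => rfl
  have hg : Submodule.span K (Set.range g) = ⊤ := by
    refine eq_top_iff.2 fun y _ => ?_
    induction y with
    | zero => exact zero_mem _
    | add x y hx hy => exact add_mem (hx trivial) (hy trivial)
    | tmul a y =>
      induction y with
      | zero => rw [TensorProduct.tmul_zero]; exact zero_mem _
      | add x y hx hy => rw [TensorProduct.tmul_add]; exact add_mem (hx trivial) (hy trivial)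
      | tmul q x =>
        have : a ⊗ₜ[ℚ] (q ⊗ₜ[ℤ] x) = (q • a) • g x := by
          rw [hgx, TensorProduct.smul_tmul', smul_eq_mul, mul_one, TensorProduct.smul_tmul,
            TensorProduct.smul_tmul', smul_eq_mul, mul_one]
        rw [this]
        exact Submodule.smul_mem _ _ (Submodule.subset_span ⟨x, rfl⟩)
  have hmap : ∀ (α : AddMonoid.End G) x,
      (rationalExtension α).baseChange K (g x) = g (α x) := fun α x => by
    rw [hgx, LinearMap.baseChange_tmul, rationalExtension, LinearMap.baseChange_tmul]
    rfl
  obtain ⟨I, -, -, hI, hdet⟩ := h.exists_indices (RingHom.id K) g hg _ _ (hmap φ) (hmap ψ)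
  have hd : Module.finrank K (K ⊗[ℚ] (ℚ ⊗[ℤ] G)) = d := by
    obtain ⟨W, π, hW, -⟩ := h
    have := hW.finrank_eq (Fin.last d)
    rwa [hW.top, finrank_top] at this
  rw [← LinearMap.det_baseChange, hdet n _ (hmap _), hI hd]
  rfl

/-- The contribution of a prime `p`. -/
theorem IsJointEigenvalueNumbering.exists_padic_indices {G : Type*} [AddCommGroup G]
    [IsAddTorsionFree G] [FiniteDimensional ℚ (ℚ ⊗[ℤ] G)]
    {φ ψ : AddMonoid.End G} {K : Type*} [Field K] [Algebra ℚ K] {d : ℕ} {ξ η : Fin d → K}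
    (h : IsJointEigenvalueNumbering (rationalExtension φ) (rationalExtension ψ) ξ η)
    (p : ℕ) [Fact p.Prime] (s : K →+* PadicAlgCl p) :
    ∃ I : Finset (Fin d),
      (∃ P : ℤ_[p][X], P.Monic ∧ P.map (algebraMap ℤ_[p] (PadicAlgCl p)) =
        ∏ i ∈ I, (Polynomial.X - Polynomial.C (s (ξ i)))) ∧
      (∃ P : ℤ_[p][X], P.Monic ∧ P.map (algebraMap ℤ_[p] (PadicAlgCl p)) =
        ∏ i ∈ I, (Polynomial.X - Polynomial.C (s (η i)))) ∧
      ∀ n : ℕ, (∀ i, s (ξ i) ^ n - s (η i) ^ n ≠ 0) →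
        Finite (G ⧸ LinearMap.range (AddMonoidHom.toIntLinearMap (φ ^ n - ψ ^ n))) →
        ‖(Nat.card (G ⧸ LinearMap.range (AddMonoidHom.toIntLinearMap (φ ^ n - ψ ^ n))) :
          ℚ_[p])‖⁻¹ = ∏ i ∈ I, ‖s (ξ i) ^ n - s (η i) ^ n‖⁻¹ := by
  have := padicHull.free (p := p) (G := G)
  have := padicHull.finite (p := p) (G := G)
  let g : G →+ PadicAlgCl p ⊗[ℤ_[p]] padicHull p G :=
    ((TensorProduct.mk ℤ_[p] (PadicAlgCl p) (padicHull p G) 1).toAddMonoidHom).comp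
      (padicHull.of p G)
  have hgx : ∀ x, g x = 1 ⊗ₜ padicHull.of p G x := fun _ => rfl
  have hg : Submodule.span (PadicAlgCl p) (Set.range g) = ⊤ := by
    have h1 : (Submodule.span ℤ_[p] (Set.range (padicHull.of p G))).baseChange (PadicAlgCl p) = _ :=
      Submodule.baseChange_span _ _
    rw [padicHull.span_range_of, Submodule.baseChange_top, ← Set.range_comp] at h1
    exact h1.symm
  have hmap : ∀ (α : AddMonoid.End G) x,
      (padicHull.map α).baseChange (PadicAlgCl p) (g x) = g (α x) := fun α x => by
    rw [hgx, LinearMap.baseChange_tmul, padicHull.map_of, hgx]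
  obtain ⟨I, hIφ, hIψ, -, hdet⟩ := h.exists_indices s g hg _ _ (hmap φ) (hmap ψ)
  refine ⟨I, ⟨(padicHull.map φ).charpoly, LinearMap.charpoly_monic _, ?_⟩,
    ⟨(padicHull.map ψ).charpoly, LinearMap.charpoly_monic _, ?_⟩, fun n hn hfin => ?_⟩
  · rw [← hIφ, LinearMap.charpoly_baseChange]
  · rw [← hIψ, LinearMap.charpoly_baseChange]
  · have hdetn := hdet n _ (hmap _)
    rw [LinearMap.det_baseChange] at hdetn
    -- The determinant on the hull is a subproduct of nonzero factors.
    have hne : LinearMap.det (padicHull.map (p := p) (φ ^ n - ψ ^ n)) ≠ 0 := fun h0 => by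
      rw [h0, map_zero, eq_comm, Finset.prod_eq_zero_iff] at hdetn
      obtain ⟨i, -, hi⟩ := hdetn
      exact hn i hi
    have hcard := padicHull.card_quotient_range (p := p)
      (AddMonoidHom.toIntLinearMap (φ ^ n - ψ ^ n)) (padicHull.map (φ ^ n - ψ ^ n)) fun x => rfl
    rw [card_quotient_range_eq_norm_det _ hne] at hcard
    rw [Finset.prod_inv_distrib, ← norm_prod, ← hdetn,
      IsScalarTower.algebraMap_apply ℤ_[p] ℚ_[p] (PadicAlgCl p)]
    refine Eq.trans ?_ (hcard.symm.trans (congrArg _ (PadicAlgCl.norm_extends p _).symm))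
    rw [PadicInt.norm_def, PadicInt.coe_natCast]

end Reidemeister

/-! ### Assembling the theorem -/

theorem finiteDimensional_rat_tensor {G : Type*} [AddCommGroup G] {d : ℕ}
    (hrank : Module.rank ℤ G = (d : Cardinal)) : FiniteDimensional ℚ (ℚ ⊗[ℤ] G) := by
  rw [FiniteDimensional, ← Module.rank_lt_aleph0_iff, IsFractionRing.rank_right_eq ℤ ℚ]
  have h := IsLocalizedModule.rank_eq (nonZeroDivisors ℤ) le_rfl (TensorProduct.mk ℤ ℚ G 1)
  rw [hrank] at h
  exact h.trans_lt Cardinal.natCast_lt_aleph0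

theorem hasPadicIntCoeffs_map {p : ℕ} [Fact p.Prime] (P : ℤ_[p][X]) :
    HasPadicIntCoeffs p (P.map (algebraMap ℤ_[p] (PadicAlgCl p))) := fun k =>
  ⟨P.coeff k, by
    rw [Polynomial.coeff_map, IsScalarTower.algebraMap_apply ℤ_[p] ℚ_[p] (PadicAlgCl p)]; rfl⟩

theorem norm_le_one_of_map_eq_prod {p : ℕ} [Fact p.Prime] {P : ℤ_[p][X]} (hP : P.Monic)
    {ι : Type*} {I : Finset ι} {c : ι → PadicAlgCl p}
    (h : P.map (algebraMap ℤ_[p] (PadicAlgCl p)) =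
      ∏ i ∈ I, (Polynomial.X - Polynomial.C (c i))) {i : ι} (hi : i ∈ I) : ‖c i‖ ≤ 1 := by
  refine PadicAlgCl.norm_le_one_of_isIntegral ⟨P, hP, ?_⟩
  rw [← Polynomial.eval_map, h, Polynomial.eval_prod]
  exact Finset.prod_eq_zero hi (by simp)

theorem mainTheorem3
    {G : Type*} [AddCommGroup G] [IsAddTorsionFree G]
    (d : ℕ) (hd : 1 ≤ d) (hrank : Module.rank ℤ G = (d : Cardinal))
    (φ ψ : AddMonoid.End G) (htame : IsTamePair φ ψ)
    (htri : SimultaneouslyTriangularisable (rationalExtension φ) (rationalExtension ψ))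
    {K : Type*} [Field K] [Algebra ℚ K] [IsAlgClosure ℚ K]
    (ξ η : Fin d → K)
    (hξη : IsJointEigenvalueNumbering (rationalExtension φ) (rationalExtension ψ) ξ η)
    (σ : ∀ p : Nat.Primes, eigenvalueField ξ η →+* PadicAlgCl p)
    (τ : eigenvalueField ξ η →+* ℂ) :
    ∃ I : Nat.Primes → Finset (Fin d),
      (∀ p : Nat.Primes,
        HasPadicIntCoeffs p
          (∏ i ∈ I p, (Polynomial.X - Polynomial.C (σ p (eigenvalueFst ξ η i)))) ∧
        HasPadicIntCoeffs p
          (∏ i ∈ I p, (Polynomial.X - Polynomial.C (σ p (eigenvalueSnd ξ η i)))) ∧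
        ∀ i ∈ I p,
          ‖σ p (eigenvalueFst ξ η i)‖ ≤ 1 ∧ ‖σ p (eigenvalueSnd ξ η i)‖ ≤ 1) ∧
      ∀ n : ℕ, 1 ≤ n →
        {p : Nat.Primes | ∃ i : Fin d,
          ‖σ p (eigenvalueFst ξ η i) ^ n - σ p (eigenvalueSnd ξ η i) ^ n‖ ≠ 1}.Finite ∧
        ∃ R : ℕ, 0 < R ∧ reidemeisterNumber (φ ^ n) (ψ ^ n) = (R : ℕ∞) ∧
          (R : ℝ) = ∏ᶠ p : Nat.Primes, ∏ i ∈ I p,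
            ‖σ p (eigenvalueFst ξ η i) ^ n - σ p (eigenvalueSnd ξ η i) ^ n‖⁻¹ ∧
          (R : ℝ) =
            (∏ i : Fin d, ‖τ (eigenvalueFst ξ η i) ^ n - τ (eigenvalueSnd ξ η i) ^ n‖) *
            ∏ᶠ p : Nat.Primes, ∏ i ∈ (I p)ᶜ,
              ‖σ p (eigenvalueFst ξ η i) ^ n - σ p (eigenvalueSnd ξ η i) ^ n‖ := by
  have hfd := finiteDimensional_rat_tensor hrank
  -- The flag lives over K, so each embedding of L must be extended to K, which is algebraic over L.
  have hext : ∀ p : Nat.Primes, ∃ s : K →+* PadicAlgCl p,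
      ∀ x : eigenvalueField ξ η, s x = σ p x := fun p => by
    let _ := (σ p).toAlgebra
    have : Algebra.IsAlgebraic ℚ K := IsAlgClosure.isAlgebraic
    have : Algebra.IsAlgebraic (eigenvalueField ξ η) K := Algebra.IsAlgebraic.tower_top (K := ℚ) _
    let s : K →ₐ[eigenvalueField ξ η] PadicAlgCl p := IsAlgClosed.lift
    exact ⟨s, fun x => s.commutes x⟩
  choose s hs using hext
  choose I hIφ hIψ hI using fun p : Nat.Primes => hξη.exists_padic_indices p (s p)
  have hs1 : ∀ p i, s p (ξ i) = σ p (eigenvalueFst ξ η i) := fun p i => hs p (eigenvalueFst ξ η i)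
  have hs2 : ∀ p i, s p (η i) = σ p (eigenvalueSnd ξ η i) := fun p i => hs p (eigenvalueSnd ξ η i)
  simp only [hs1, hs2] at hIφ hIψ hI
  refine ⟨I, fun p => ?_, fun n hn => ?_⟩
  · obtain ⟨P, hP, hPφ⟩ := hIφ p
    obtain ⟨Q, hQ, hQψ⟩ := hIψ p
    exact ⟨hPφ ▸ hasPadicIntCoeffs_map P, hQψ ▸ hasPadicIntCoeffs_map Q, fun i hi =>
      ⟨norm_le_one_of_map_eq_prod hP hPφ hi, norm_le_one_of_map_eq_prod hQ hQψ hi⟩⟩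
  have hfin : Finite (G ⧸ LinearMap.range (AddMonoidHom.toIntLinearMap (φ ^ n - ψ ^ n))) := by
    have := htame n hn
    rw [reidemeisterNumber_eq] at this
    exact ENat.card_lt_top.1 (lt_top_iff_ne_top.2 this)
  let x : Fin d → eigenvalueField ξ η := fun i => eigenvalueFst ξ η i ^ n - eigenvalueSnd ξ η i ^ n
  have hσx : ∀ p i, σ p (eigenvalueFst ξ η i) ^ n - σ p (eigenvalueSnd ξ η i) ^ n = σ p (x i) :=
    fun p i => by simp [x]
  have hτx : ∀ i, τ (eigenvalueFst ξ η i) ^ n - τ (eigenvalueSnd ξ η i) ^ n = τ (x i) :=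
    fun i => by simp [x]
  replace hI := fun p => hI p n
  simp only [hσx] at hI
  simp only [hσx, hτx]
  set D := LinearMap.det (rationalExtension (φ ^ n - ψ ^ n)) with hD
  have hD0 : D ≠ 0 := det_rationalExtension_ne_zero _
  have hdet : ∏ i, x i = algebraMap ℚ (eigenvalueField ξ η) D := by
    refine (algebraMap (eigenvalueField ξ η) K).injective ?_
    rw [← IsScalarTower.algebraMap_apply, hD, hξη.det_eq n, map_prod]
    rfl
  have hx0 : ∀ i, x i ≠ 0 := fun i hi => by
    rw [Finset.prod_eq_zero (Finset.mem_univ i) hi, eq_comm, map_eq_zero] at hdet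
    exact hD0 hdet
  have hxalg : ∀ i, IsAlgebraic ℤ (x i) := fun i => by
    have : Algebra.IsAlgebraic ℚ K := IsAlgClosure.isAlgebraic
    have h : IsAlgebraic ℚ (x i) :=
      (isAlgebraic_algebraMap_iff (algebraMap (eigenvalueField ξ η) K).injective).1
        (Algebra.IsAlgebraic.isAlgebraic (R := ℚ) (algebraMap (eigenvalueField ξ η) K (x i)))
    exact (IsFractionRing.isAlgebraic_iff ℤ ℚ _).2 h
  have hfinset : {p : Nat.Primes | ∃ i : Fin d, ‖σ p (x i)‖ ≠ 1}.Finite := by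
    refine (Set.finite_iUnion fun i => finite_primes_norm_ne_one (hxalg i) (hx0 i) σ).subset ?_
    rintro p ⟨i, hi⟩
    exact Set.mem_iUnion.2 ⟨i, hi⟩
  have hR := Nat.card_pos (α := G ⧸ LinearMap.range (AddMonoidHom.toIntLinearMap (φ ^ n - ψ ^ n)))
  set R := Nat.card (G ⧸ LinearMap.range (AddMonoidHom.toIntLinearMap (φ ^ n - ψ ^ n)))
  have hprod : (R : ℝ) = ∏ᶠ p : Nat.Primes, ∏ i ∈ I p, ‖σ p (x i)‖⁻¹ := by
    rw [← finprod_norm_natCast_inv hR.ne']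
    exact finprod_congr fun p => hI p (fun i => by simpa using hx0 i) hfin
  -- `finprod` is 1 by default on infinite support, so finiteness is needed to split the product
  -- over I(p) and its complement.
  have hsupp : ∀ J : Nat.Primes → Finset (Fin d),
      (Function.mulSupport fun p => ∏ i ∈ J p, ‖σ p (x i)‖).Finite := fun J =>
    hfinset.subset fun p hp => by
      by_contra h
      simp only [Set.mem_ofPred_eq, not_exists, not_not] at h
      exact hp (Finset.prod_eq_one fun i _ => h i)
  refine ⟨hfinset, R, hR, ?_, hprod, ?_⟩
  · rw [reidemeisterNumber_eq, ENat.card_eq_coe_natCard]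
  · have hτ : ∏ i, ‖τ (x i)‖ = |(D : ℝ)| := by
      rw [← norm_prod, ← map_prod, hdet, eq_ratCast, map_ratCast]
      simp
    have hσ : ∀ p : Nat.Primes, ‖(D : ℚ_[p])‖ =
        (∏ i ∈ I p, ‖σ p (x i)‖) * ∏ i ∈ (I p)ᶜ, ‖σ p (x i)‖ := fun p => by
      rw [Finset.prod_mul_prod_compl, ← norm_prod, ← map_prod, hdet, eq_ratCast, map_ratCast,
        ← PadicAlgCl.norm_extends, map_ratCast]
    -- The product formula for D, split at I(p): the I(p) part is R⁻¹, so |D| times the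
    -- complementary part is R.
    have hpf := Rat.abs_mul_finprod_norm_eq_one hD0
    simp_rw [hσ] at hpf
    rw [finprod_mul_distrib (hsupp _) (hsupp _)] at hpf
    simp_rw [Finset.prod_inv_distrib] at hprod
    rw [finprod_inv_distrib] at hprod
    rw [hτ, hprod]
    rw [mul_left_comm] at hpf
    exact (eq_inv_of_mul_eq_one_right hpf).symm
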